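/- Let $n\ge 1$, and let items $1,\dots,n$ have profits $c_i>0$ and success probabilities $0<p_i<1$ (real numbers). For $S\subseteq\{1,\dots,n\}$ put $v(S)=\bigl(\sum_{i\in S}c_i\bigr)\prod_{j\in S}p_j$, and let $\mathrm{OPT}=\max_S v(S)$. Given $\varepsilon>0$, Algorithm 1 works as follows. 1. Split the items into $N=\{i: p_i\ge \tfrac12\}$ and its complement $M=\{i: p_i<\tfrac12\}$. Set $z_{\max}=\max_{1\le j\le n} c_jp_j$, the best single-item solution. If $N=\emptyset$, return $z_{\max}$. 2. Let $\kappa=\varepsilon\,\max_{i\in N}p_ic_i/n$ and $\hat c_i=\lfloor c_i/\kappa\rfloor$ for all $i$. Let $\bar C=\sum_{i\in N}\hat c_i$. 3. For every $j\in M$, and for a dummy item $j$ with $\hat c_j=0$ and $p_j=1$, do the following. List $N$ as $i_1,\dots,i_h$ and compute the table $\hat P(k,C)$, $0\le k\le h$, $0\le C\le\bar C$, by $$\hat P(0,0)=1,\qquad \hat P(0,C)=0\ \ (C>0),$$ $$\hat P(k,C)=\begin{cases}\max\{\hat P(k-1,C),\ p_{i_k}\hat P(k-1,C-\hat c_{i_k})\}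 & \text{if } \hat c_{i_k}\le C,\\ \hat P(k-1,C)&\text{otherwise.}\end{cases}$$ Then compute $\hat z_j=\max\{(C+\hat c_j)\,\hat P(h,C)\,p_j:\ \min_{i\in N}\hat c_i\le C\le\bar C\}$ and replace $z_{\max}$ by $\max\{z_{\max},\kappa\hat z_j\}$. 4. Return $z_{\max}$. Then Algorithm 1 is a fully polynomial time approximation scheme for computing $\mathrm{OPT}$: for every such instance and every $\varepsilon>0$ the returned value satisfies $$(1-\varepsilon)\,\mathrm{OPT}\ \le\ z_{\max}\ \le\ \mathrm{OPT},$$ and there is an absolute constant $K$ such that for all $0<\varepsilon\le 1$ the algorithm performs at most $K n^4/\varepsilon$ elementary steps, where every arithmetic operation, rounding, comparison, memory access and loop iteration counts as one step. -/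

import Mathlib

namespace AllOrNothing

/-! ## The optimization problem -/

/-- Expected value of the subset `S`: total profit times the probability that all of `S` succeeds. -/
noncomputable def value {n : ℕ} (c p : Fin n → ℝ) (S : Finset (Fin n)) : ℝ :=
  (∑ i ∈ S, c i) * ∏ j ∈ S, p j

/-- The maximum expected value over all subsets of the items. -/
noncomputable def opt {n : ℕ} (c p : Fin n → ℝ) : ℝ :=
  (Finset.univ : Finset (Finset (Fin n))).sup' Finset.univ_nonempty (value c p)

/-! ## Cost model

Unit-cost random access machine: a computation is a result together with the number of elementary
steps spent. Every arithmetic operation, rounding, comparison, memory access and loop iteration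
costs one step; everything else only passes results on. -/

/-- A result together with the number of elementary steps used to obtain it. -/
structure Timed (α : Type) where
  val : α
  steps : ℕ

/-- Sequential composition adds the step counts. -/
instance : Monad Timed where
  pure a := ⟨a, 0⟩
  bind x f := ⟨(f x.val).val, x.steps + (f x.val).steps⟩

/-- One elementary step with result `a`. It is used only through the primitives below. -/
def step {α : Type} (a : α) : Timed α := ⟨a, 1⟩

/-- Real multiplication. -/
noncomputable def mulR (x y : ℝ) : Timed ℝ := step (x * y)

/-- Real division. -/
noncomputable def divR (x y : ℝ) : Timed ℝ := step (x / y)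

/-- Comparison of reals. -/
noncomputable def leR (x y : ℝ) : Timed Bool := step (decide (x ≤ y))

/-- Maximum of two reals. -/
noncomputable def maxR (x y : ℝ) : Timed ℝ := step (max x y)

/-- Rounding a nonnegative real down to an integer. -/
noncomputable def floorR (x : ℝ) : Timed ℕ := step ⌊x⌋₊

/-- Conversion of an integer to a real. -/
noncomputable def castR (k : ℕ) : Timed ℝ := step (k : ℝ)

/-- Integer addition. -/
def addN (a b : ℕ) : Timed ℕ := step (a + b)

/-- Integer subtraction (used only for `b ≤ a`). -/
def subN (a b : ℕ) : Timed ℕ := step (a - b)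

/-- Comparison of integers. -/
def leN (a b : ℕ) : Timed Bool := step (decide (a ≤ b))

/-- Minimum of two integers. -/
def minN (a b : ℕ) : Timed ℕ := step (min a b)

/-- Reading one cell of an array. -/
def readA {ι α : Type} (a : ι → α) (i : ι) : Timed α := step (a i)

/-- Writing one cell of an array. -/
def writeA {ι α : Type} [DecidableEq ι] (a : ι → α) (i : ι) (v : α) : Timed (ι → α) :=
  step (Function.update a i v)

/-- Putting an element in front of a list. -/
def consL {α : Type} (x : α) (l : List α) : Timed (List α) := step (x :: l)

/-- A loop over the entries of `l` with loop state `s`; each iteration costs one step in addition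
to its body. -/
def loop {ι σ : Type} (l : List ι) (s : σ) (body : ι → σ → Timed σ) : Timed σ :=
  match l with
  | [] => pure s
  | i :: l => do
      let i ← step i
      let s ← body i s
      loop l s body

/-! ## The algorithm -/

section Algorithm

variable {n : ℕ}

/-- Splits the items into those with `p i ≥ 1/2` (first list) and those with `p i < 1/2`. -/
noncomputable def splitItems (p : Fin n → ℝ) : Timed (List (Fin n) × List (Fin n)) :=
  loop (List.finRange n) ([], []) fun i s => do
    let q ← readA p i
    if ← leR (1 / 2) q then
      let l ← consL i s.1
      pure (l, s.2)
    else
      let l ← consL i s.2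
      pure (s.1, l)

/-- `z ← max z (c j * p j)`: compares the incumbent `z` with the single-item solution `{j}`. -/
noncomputable def trySingle (c p : Fin n → ℝ) (j : Fin n) (z : ℝ) : Timed ℝ := do
  let a ← readA c j
  let q ← readA p j
  let v ← mulR a q
  maxR z v

/-- The scaling factor `κ = ε * max_{i ∈ big} (p i * c i) / n`. -/
noncomputable def scaleFactor (c p : Fin n → ℝ) (ε : ℝ) (big : List (Fin n)) : Timed ℝ := do
  let m ← loop big 0 (trySingle c p)
  let a ← mulR ε m
  let N ← castR n
  divR a N

/-- The scaled profits `⌊c i / κ⌋`. -/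
noncomputable def scaleProfits (c : Fin n → ℝ) (κ : ℝ) : Timed (Fin n → ℕ) :=
  loop (List.finRange n) (fun _ => 0) fun i ch => do
    let a ← readA c i
    let b ← divR a κ
    let w ← floorR b
    writeA ch i w

/-- The sum of the scaled profits of the items in `big`. -/
def sumProfits (ch : Fin n → ℕ) (big : List (Fin n)) : Timed ℕ :=
  loop big 0 fun i t => do
    let w ← readA ch i
    addN t w

/-- The minimum of `a` and the scaled profits of the items in `big`. -/
def minProfit (ch : Fin n → ℕ) (big : List (Fin n)) (a : ℕ) : Timed ℕ :=
  loop big a fun i t => do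
    let w ← readA ch i
    minN t w

/-- The row of the dynamic program for no items: entry `1` at profit `0`, and `0` at the
profits `1, …, B`. -/
noncomputable def initialRow (B : ℕ) : Timed (ℕ → ℝ) :=
  loop (List.range (B + 1)) (fun _ => 0) fun C row => do
    if ← leN C 0 then writeA row C 1 else writeA row C 0

/-- One stage of the dynamic program, adding item `i`: for `C = 0, …, B`,
`new C = max (old C) (p i * old (C - ch i))` if `ch i ≤ C`, and `new C = old C` otherwise. -/
noncomputable def dpStage (ch : Fin n → ℕ) (p : Fin n → ℝ) (B : ℕ) (i : Fin n) (old : ℕ → ℝ) :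
    Timed (ℕ → ℝ) := do
  let w ← readA ch i
  let q ← readA p i
  loop (List.range (B + 1)) (fun _ => 0) fun C new => do
    let a ← readA old C
    if ← leN w C then
      let d ← subN C w
      let b ← readA old d
      let b ← mulR q b
      let v ← maxR a b
      writeA new C v
    else
      writeA new C a

/-- The scaled dynamic program over the items in `big`, with an extra item of scaled profit `w` and
probability `q` forced into the solution. With `P C` the final row, it returns the maximum of
`(C + w) * P C * q` over `C = (min of ch on big), …, (sum of ch on big)`. -/
noncomputable def scaledDP (ch : Fin n → ℕ) (p : Fin n → ℝ) (big : List (Fin n)) (w : ℕ) (q : ℝ) :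
    Timed ℝ := do
  let B ← sumProfits ch big
  let lo ← minProfit ch big B
  let row ← initialRow B
  let row ← loop big row (dpStage ch p B)
  loop (List.range' lo (B + 1 - lo)) 0 fun C z => do
    let t ← addN C w
    let t ← castR t
    let a ← readA row C
    let v ← mulR t a
    let v ← mulR v q
    maxR z v

/-- The approximation scheme. The incumbent `z` starts at `0` and runs through
* all single-item solutions;
* if some item has `p i ≥ 1/2`: the values `κ * ẑ j`, where `ẑ j` is the optimum of the scaled
  dynamic program over the items with `p i ≥ 1/2` together with the extra item `j`, for every item
  `j` with `p j < 1/2` and for a dummy item of profit `0` and probability `1`.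

Without items of probability at least `1/2` there is no `κ` and nothing to run the dynamic
program on. -/
noncomputable def approxScheme (c p : Fin n → ℝ) (ε : ℝ) : Timed ℝ := do
  let (big, small) ← splitItems p
  let z ← loop small 0 (trySingle c p)
  let z ← loop big z (trySingle c p)
  match big with
  | [] => pure z
  | _ :: _ =>
      let κ ← scaleFactor c p ε big
      let ch ← scaleProfits c κ
      let z ← loop small z fun j z => do
        let w ← readA ch j
        let q ← readA p j
        let v ← scaledDP ch p big w q
        let v ← mulR κ v
        maxR z v
      let v ← scaledDP ch p big 0 1
      let v ← mulR κ v
      maxR z v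

end Algorithm

end AllOrNothing

namespace AllOrNothing

open Finset

/-! ## Loops -/

/-! An optimal set contains at most one item of probability below 1/2. If `S` is optimal with total
profit C and contains such an `i`, deleting `i` cannot help, so C - c_i ≤ p_i C < C/2 and hence c_i
> C/2; two such items would exceed C (`half_sum_lt_of_value_eq_opt`, `eq_of_value_eq_opt`). So it
suffices to try each small item, or none, together with subsets of the big items, over which the
dynamic program is exact for the scaled profits (`isTable_loop`).

Rounding down means that no candidate exceeds the true value of its set, which gives the upper
bound. Each item loses at most κ, so a set loses at most nκ = εm in profit, where m is the best
single big item; since m ≤ OPT and probabilities are at most 1, the loss in value is at most ε OPT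
(`one_sub_mul_value_le`). The program covers only nonempty sets of big items; an optimum without big
items is empty or a singleton.

For the running time, a big item has c_i ≤ 2 p_i c_i ≤ 2m, so its scaled profit is at most 2n/ε and
the table has O(n²/ε) columns (`sum_scaled_le`). At most n + 1 runs of at most n stages give
O(n⁴/ε). -/

@[simp] theorem bind_val {α β : Type} (x : Timed α) (f : α → Timed β) :
    (x >>= f).val = (f x.val).val := rfl

@[simp] theorem bind_steps {α β : Type} (x : Timed α) (f : α → Timed β) :
    (x >>= f).steps = x.steps + (f x.val).steps := rfl

@[simp] theorem pure_val {α : Type} (a : α) : (pure a : Timed α).val = a := rfl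

@[simp] theorem pure_steps {α : Type} (a : α) : (pure a : Timed α).steps = 0 := rfl

@[simp] theorem step_val {α : Type} (a : α) : (step a).val = a := rfl

@[simp] theorem step_steps {α : Type} (a : α) : (step a).steps = 1 := rfl

section Loop

variable {ι σ : Type}

theorem loop_val (l : List ι) (s : σ) (body : ι → σ → Timed σ) :
    (loop l s body).val = l.foldl (fun s i => (body i s).val) s := by
  induction l generalizing s with
  | nil => rfl
  | cons i l ih => simp [loop, ih]

theorem loop_steps_le (l : List ι) (s : σ) (body : ι → σ → Timed σ) (k : ℕ)
    (h : ∀ i s, (body i s).steps ≤ k) : (loop l s body).steps ≤ l.length * (k + 1) := by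
  induction l generalizing s with
  | nil => simp [loop]
  | cons i l ih =>
    have h1 := h i s
    have h2 := ih (body i s).val
    simp only [loop, bind_steps, step_steps, step_val, List.length_cons]
    linarith

/-- The value written to cell `i` does not depend on the state, so order and repetitions in the list
are irrelevant. -/
theorem loop_update_val {α : Type} [DecidableEq ι] (l : List ι) (s : ι → α)
    (body : ι → (ι → α) → Timed (ι → α)) (g : ι → α)
    (h : ∀ i s, (body i s).val = Function.update s i (g i)) (j : ι) :
    (loop l s body).val j = if j ∈ l then g j else s j := by
  rw [loop_val]
  induction l generalizing s with
  | nil => simp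
  | cons i l ih =>
    rw [List.foldl_cons, ih, h]
    by_cases hj : j = i
    · subst hj; simp
    · simp [hj]

theorem foldl_max_le_iff {α : Type} [LinearOrder α] (l : List ι) (f : ι → α) (z x : α) :
    l.foldl (fun z i => max z (f i)) z ≤ x ↔ z ≤ x ∧ ∀ i ∈ l, f i ≤ x := by
  induction l generalizing z with
  | nil => simp
  | cons i l ih => simp [ih, and_assoc]

theorem le_foldl_min_iff {α : Type} [LinearOrder α] (l : List ι) (f : ι → α) (z x : α) :
    x ≤ l.foldl (fun z i => min z (f i)) z ↔ x ≤ z ∧ ∀ i ∈ l, x ≤ f i :=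
  foldl_max_le_iff (α := αᵒᵈ) l f z x

/-- Describing a computed maximum by its upper bounds serves both directions: taking `x` to be the
result itself shows that it dominates every candidate. -/
theorem loop_max_le_iff (l : List ι) (z x : ℝ) (body : ι → ℝ → Timed ℝ) (f : ι → ℝ)
    (h : ∀ i z, (body i z).val = max z (f i)) :
    (loop l z body).val ≤ x ↔ z ≤ x ∧ ∀ i ∈ l, f i ≤ x := by
  rw [loop_val]
  simp only [h]
  exact foldl_max_le_iff l f z x

end Loop

/-! ## Values of the subroutines -/

section Values

variable {n : ℕ}

theorem splitItems_val (p : Fin n → ℝ) :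
    (splitItems p).val = (((List.finRange n).filter (fun i => 1 / 2 ≤ p i)).reverse,
      ((List.finRange n).filter (fun i => ¬ 1 / 2 ≤ p i)).reverse) := by
  suffices h : ∀ (l a b : List (Fin n)),
      l.foldl (fun s i => if 1 / 2 ≤ p i then (i :: s.1, s.2) else (s.1, i :: s.2)) (a, b) =
        ((l.filter (fun i => 1 / 2 ≤ p i)).reverse ++ a,
          (l.filter (fun i => ¬ 1 / 2 ≤ p i)).reverse ++ b) by
    rw [splitItems, loop_val]
    refine Eq.trans ?_ ((h (List.finRange n) [] []).trans (by simp))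
    congr 1
    ext1 s; ext1 i
    by_cases hi : 1 / 2 ≤ p i
    · have hi' : 2⁻¹ ≤ p i := by simpa using hi
      simp [readA, leR, consL, hi']
    · have hi' : ¬ 2⁻¹ ≤ p i := by simpa using hi
      simp [readA, leR, consL, hi']
  intro l
  induction l with
  | nil => simp
  | cons i l ih =>
    intro a b
    rw [List.foldl_cons]
    by_cases hi : 1 / 2 ≤ p i
    · rw [if_pos hi, ih, List.filter_cons_of_pos (by simpa using hi),
        List.filter_cons_of_neg (by simpa using hi)]
      simp
    · rw [if_neg hi, ih, List.filter_cons_of_neg (by simpa using hi),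
        List.filter_cons_of_pos (by simpa using hi)]
      simp

theorem trySingle_val (c p : Fin n → ℝ) (j : Fin n) (z : ℝ) :
    (trySingle c p j z).val = max z (c j * p j) := rfl

theorem scaleFactor_val (c p : Fin n → ℝ) (ε : ℝ) (big : List (Fin n)) :
    (scaleFactor c p ε big).val = ε * (loop big 0 (trySingle c p)).val / n := rfl

theorem scaleProfits_val (c : Fin n → ℝ) (κ : ℝ) :
    (scaleProfits c κ).val = fun i => ⌊c i / κ⌋₊ := by
  ext1 i
  rw [scaleProfits, loop_update_val _ _ _ (fun i => ⌊c i / κ⌋₊) (fun _ _ => rfl)]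
  simp

theorem sumProfits_val (ch : Fin n → ℕ) {big : List (Fin n)} (hbig : big.Nodup) :
    (sumProfits ch big).val = ∑ i ∈ big.toFinset, ch i := by
  rw [sumProfits, loop_val, List.sum_toFinset _ hbig, List.sum_eq_foldl, List.foldl_map]
  rfl

theorem minProfit_val_le (ch : Fin n → ℕ) (big : List (Fin n)) (a : ℕ) {i : Fin n}
    (hi : i ∈ big) : (minProfit ch big a).val ≤ ch i := by
  rw [minProfit, loop_val]
  exact ((le_foldl_min_iff big ch a _).1 le_rfl).2 i hi

theorem initialRow_val (B C : ℕ) : (initialRow B).val C = if C = 0 then 1 else 0 := by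
  rw [initialRow, loop_update_val _ _ _ (fun C => if C = 0 then 1 else 0)]
  · by_cases h : C = 0 <;> simp [h]
  · intro i s
    by_cases h : i = 0 <;> simp [leN, writeA, h]

theorem dpStage_val (ch : Fin n → ℕ) (p : Fin n → ℝ) {B C : ℕ} (i : Fin n) (old : ℕ → ℝ)
    (hC : C ≤ B) : (dpStage ch p B i old).val C =
      if ch i ≤ C then max (old C) (p i * old (C - ch i)) else old C := by
  simp only [dpStage, bind_val, readA, step_val]
  rw [loop_update_val _ _ _
    (fun C => if ch i ≤ C then max (old C) (p i * old (C - ch i)) else old C)]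
  · simp [Nat.lt_succ_of_le hC]
  · intro j s
    by_cases h : ch i ≤ j <;> simp [leN, writeA, subN, mulR, maxR, h]

/-- The row `row` of the dynamic program, up to profit `B`, is the table of the largest success
probabilities of subsets of `D` with given scaled profit. -/
structure IsTable (ch : Fin n → ℕ) (p : Fin n → ℝ) (B : ℕ) (D : Finset (Fin n))
    (row : ℕ → ℝ) : Prop where
  attained : ∀ C ≤ B, row C = 0 ∨ ∃ T ⊆ D, ∑ i ∈ T, ch i = C ∧ ∏ i ∈ T, p i = row C
  le_row : ∀ T ⊆ D, ∑ i ∈ T, ch i ≤ B → ∏ i ∈ T, p i ≤ row (∑ i ∈ T, ch i)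

theorem isTable_initialRow (ch : Fin n → ℕ) (p : Fin n → ℝ) (B : ℕ) :
    IsTable ch p B ∅ (initialRow B).val where
  attained C _ := by
    by_cases h : C = 0
    · exact Or.inr ⟨∅, Subset.rfl, by simp [h, initialRow_val]⟩
    · exact Or.inl (by simp [h, initialRow_val])
  le_row T hT _ := by
    rw [Finset.subset_empty.1 hT]
    simp [initialRow_val]

/-- The two arguments of the maximum correspond to sets without and with `i`. As `i ∉ D`, adding `i`
to a subset of `D` contributes exactly one factor `p i` and one summand `ch i`. -/
theorem IsTable.dpStage {ch : Fin n → ℕ} {p : Fin n → ℝ} {B : ℕ} {D : Finset (Fin n)}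
    {row : ℕ → ℝ} (h : IsTable ch p B D row) {i : Fin n} (hp : 0 ≤ p i) (hi : i ∉ D) :
    IsTable ch p B (insert i D) (dpStage ch p B i row).val where
  attained C hC := by
    have old : row C = 0 ∨ ∃ T ⊆ insert i D, ∑ i ∈ T, ch i = C ∧ ∏ i ∈ T, p i = row C :=
      (h.attained C hC).imp_right fun ⟨T, hT, hT'⟩ => ⟨T, hT.trans (subset_insert i D), hT'⟩
    rw [dpStage_val ch p i row hC]
    split_ifs with hw
    · rcases max_choice (row C) (p i * row (C - ch i)) with hm | hm
      · rwa [hm]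
      · rw [hm]
        rcases h.attained (C - ch i) ((Nat.sub_le _ _).trans hC) with h0 | ⟨T, hT, hs, hprod⟩
        · exact Or.inl (by rw [h0, mul_zero])
        · have hiT : i ∉ T := fun hiT => hi (hT hiT)
          refine Or.inr ⟨insert i T, insert_subset_insert i hT, ?_, ?_⟩
          · rw [sum_insert hiT, hs]; omega
          · rw [prod_insert hiT, hprod]
    · exact old
  le_row T hT hB := by
    rw [dpStage_val ch p i row hB]
    by_cases hiT : i ∈ T
    · have hsub : T.erase i ⊆ D := by
        intro x hx
        exact (mem_insert.1 (hT (mem_of_mem_erase hx))).resolve_left (ne_of_mem_erase hx)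
      have hs := add_sum_erase T ch hiT
      rw [if_pos (by omega), ← hs, Nat.add_sub_cancel_left, ← mul_prod_erase T p hiT]
      exact le_max_of_le_right
        (mul_le_mul_of_nonneg_left (h.le_row _ hsub (by omega)) hp)
    · have hsub : T ⊆ D := (subset_insert_iff_of_notMem hiT).1 hT
      have := h.le_row T hsub hB
      split_ifs
      · exact le_max_of_le_left this
      · exact this

theorem isTable_loop {ch : Fin n → ℕ} {p : Fin n → ℝ} (hp : ∀ i, 0 ≤ p i) {B : ℕ}
    {big : List (Fin n)} (hbig : big.Nodup) :
    IsTable ch p B big.toFinset (loop big (initialRow B).val (dpStage ch p B)).val := by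
  -- Generalize to an arbitrary set `D` of items already processed, disjoint from the remaining
  -- list.
  suffices h : ∀ (D : Finset (Fin n)) (row : ℕ → ℝ), IsTable ch p B D row →
      (∀ i ∈ big, i ∉ D) → IsTable ch p B (big.toFinset ∪ D) (loop big row (dpStage ch p B)).val by
    simpa using h ∅ _ (isTable_initialRow ch p B)
  simp only [loop_val]
  induction big with
  | nil => intro D row h _; simpa using h
  | cons i l ih =>
    intro D row h hd
    rw [List.nodup_cons] at hbig
    have := ih hbig.2 (insert i D) _ (h.dpStage (hp i) (hd i (by simp))) (by
      intro j hj hj'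
      rcases mem_insert.1 hj' with rfl | hj'
      · exact hbig.1 hj
      · exact hd j (by simp [hj]) hj')
    simpa using this

/-- Each entry in range is zero or comes from an actual set; `hx` handles the zero entries and the
initial incumbent 0. -/
theorem scaledDP_val_le {ch : Fin n → ℕ} {p : Fin n → ℝ} (hp : ∀ i, 0 ≤ p i)
    {big : List (Fin n)} (hbig : big.Nodup) {w : ℕ} {q x : ℝ} (hx : 0 ≤ x)
    (h : ∀ T ⊆ big.toFinset, ((∑ i ∈ T, ch i + w : ℕ) : ℝ) * (∏ i ∈ T, p i) * q ≤ x) :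
    (scaledDP ch p big w q).val ≤ x := by
  simp only [scaledDP, bind_val]
  rw [loop_max_le_iff _ _ _ _ _ fun _ _ => rfl]
  refine ⟨hx, fun C hC => ?_⟩
  rw [List.mem_range'_1] at hC
  rcases (isTable_loop (ch := ch) hp hbig).attained C
    (show C ≤ (sumProfits ch big).val by omega) with h0 | ⟨T, hT, rfl, hT'⟩
  · simpa [readA, castR, addN, mulR, h0] using hx
  · simpa [readA, castR, addN, mulR, ← hT'] using h T hT

/-- Nonemptiness of `T` is what puts its scaled profit above the lower limit of the final loop. -/
theorem le_scaledDP_val {ch : Fin n → ℕ} {p : Fin n → ℝ} (hp : ∀ i, 0 ≤ p i)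
    {big : List (Fin n)} (hbig : big.Nodup) (w : ℕ) {q : ℝ} (hq : 0 ≤ q) {T : Finset (Fin n)}
    (hT : T ⊆ big.toFinset) (hne : T.Nonempty) :
    ((∑ i ∈ T, ch i + w : ℕ) : ℝ) * (∏ i ∈ T, p i) * q ≤ (scaledDP ch p big w q).val := by
  have hB : ∑ i ∈ T, ch i ≤ (sumProfits ch big).val := by
    rw [sumProfits_val ch hbig]
    exact sum_le_sum_of_subset hT
  have hlo : (minProfit ch big (sumProfits ch big).val).val ≤ ∑ i ∈ T, ch i := by
    obtain ⟨i, hi⟩ := hne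
    exact (minProfit_val_le ch big _ (List.mem_toFinset.1 (hT hi))).trans
      (single_le_sum (fun _ _ => Nat.zero_le _) hi)
  have hrow := (isTable_loop (ch := ch) hp hbig).le_row T hT hB
  -- Only the left side is unfolded, so that `loop_max_le_iff` turns reflexivity into a bound on
  -- every candidate.
  have hmax : (scaledDP ch p big w q).val ≤ (scaledDP ch p big w q).val := le_rfl
  nth_rewrite 1 [scaledDP] at hmax
  simp only [bind_val] at hmax
  rw [loop_max_le_iff _ _ _ _ _ fun _ _ => rfl] at hmax
  refine le_trans ?_ (hmax.2 (∑ i ∈ T, ch i) (List.mem_range'_1.2 (by omega)))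
  exact mul_le_mul_of_nonneg_right (mul_le_mul_of_nonneg_left hrow (Nat.cast_nonneg _)) hq

end Values

/-! ## Step counts of the subroutines -/

section Steps

variable {n : ℕ}

theorem splitItems_steps_le (p : Fin n → ℝ) : (splitItems p).steps ≤ 4 * n := by
  refine (loop_steps_le _ _ _ 3 fun i s => ?_).trans (by simp [mul_comm])
  by_cases h : p i < 2⁻¹
  · simp [readA, leR, consL, h.not_ge]
  · simp [readA, leR, consL, not_lt.1 h]

theorem loop_trySingle_steps_le (c p : Fin n → ℝ) (l : List (Fin n)) (z : ℝ) :
    (loop l z (trySingle c p)).steps ≤ 5 * l.length :=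
  (loop_steps_le _ _ _ 4 fun _ _ => le_rfl).trans (by omega)

theorem scaleFactor_steps_le (c p : Fin n → ℝ) (ε : ℝ) (big : List (Fin n)) :
    (scaleFactor c p ε big).steps ≤ 5 * big.length + 3 :=
  Nat.add_le_add_right (loop_trySingle_steps_le c p big 0) 3

theorem scaleProfits_steps_le (c : Fin n → ℝ) (κ : ℝ) : (scaleProfits c κ).steps ≤ 5 * n :=
  (loop_steps_le _ _ _ 4 fun _ _ => le_rfl).trans (by simp [mul_comm])

theorem sumProfits_steps_le (ch : Fin n → ℕ) (big : List (Fin n)) :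
    (sumProfits ch big).steps ≤ 3 * big.length :=
  (loop_steps_le _ _ _ 2 fun _ _ => le_rfl).trans (by omega)

theorem minProfit_steps_le (ch : Fin n → ℕ) (big : List (Fin n)) (a : ℕ) :
    (minProfit ch big a).steps ≤ 3 * big.length :=
  (loop_steps_le _ _ _ 2 fun _ _ => le_rfl).trans (by omega)

theorem initialRow_steps_le (B : ℕ) : (initialRow B).steps ≤ 3 * (B + 1) := by
  refine (loop_steps_le _ _ _ 2 fun i s => ?_).trans (by simp [mul_comm])
  by_cases h : i = 0 <;> simp [leN, writeA, h]

theorem dpStage_steps_le (ch : Fin n → ℕ) (p : Fin n → ℝ) (B : ℕ) (i : Fin n) (old : ℕ → ℝ) :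
    (dpStage ch p B i old).steps ≤ 8 * (B + 1) + 2 := by
  simp only [dpStage, bind_steps, readA, step_steps, step_val]
  refine le_trans (Nat.add_le_add_left (Nat.add_le_add_left
    (loop_steps_le _ _ _ 7 fun j s => ?_) _) _) (by simp; omega)
  by_cases h : ch i ≤ j <;> simp [leN, writeA, subN, mulR, maxR, h]

theorem scaledDP_steps_le (ch : Fin n → ℕ) (p : Fin n → ℝ) {big : List (Fin n)}
    (hlen : big.length ≤ n) (hn : 1 ≤ n) (w : ℕ) (q : ℝ) :
    (scaledDP ch p big w q).steps ≤ 27 * (n * ((sumProfits ch big).val + 1)) := by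
  simp only [scaledDP, bind_steps]
  set B := (sumProfits ch big).val
  have h1 := sumProfits_steps_le ch big
  have h2 := minProfit_steps_le ch big B
  have h3 := initialRow_steps_le B
  have h4 := loop_steps_le big (initialRow B).val (dpStage ch p B) _ (dpStage_steps_le ch p B)
  have h5 := loop_steps_le
    (List.range' (minProfit ch big B).val (B + 1 - (minProfit ch big B).val)) (0 : ℝ)
    (fun C z => do
      let t ← addN C w
      let t ← castR t
      let a ← readA (loop big (initialRow B).val (dpStage ch p B)).val C
      let v ← mulR t a
      let v ← mulR v q
      maxR z v) 6 (fun _ _ => le_rfl)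
  rw [List.length_range'] at h5
  have h6 : big.length * (8 * (B + 1) + 2 + 1) ≤ n * (8 * (B + 1) + 2 + 1) :=
    Nat.mul_le_mul_right _ hlen
  have h7 : B + 1 ≤ n * (B + 1) := Nat.le_mul_of_pos_left _ hn
  have h8 : n ≤ n * (B + 1) := Nat.le_mul_of_pos_right _ (by omega)
  have h9 : n * (8 * (B + 1) + 2 + 1) = 8 * (n * (B + 1)) + 3 * n := by ring
  -- The constant is 3 + 3 + 3 + (8 + 3) + 7 = 27.
  omega

end Steps

/-! ## Optimal solutions -/

section Opt

variable {n : ℕ} {c p : Fin n → ℝ}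

theorem value_le_opt (c p : Fin n → ℝ) (S : Finset (Fin n)) : value c p S ≤ opt c p :=
  le_sup' (value c p) (mem_univ S)

theorem exists_value_eq_opt (c p : Fin n → ℝ) : ∃ S, value c p S = opt c p := by
  obtain ⟨S, -, hS⟩ := exists_mem_eq_sup' (univ_nonempty (α := Finset (Fin n))) (value c p)
  exact ⟨S, hS.symm⟩

theorem value_singleton (c p : Fin n → ℝ) (j : Fin n) : value c p {j} = c j * p j := by
  simp [value]

theorem half_sum_lt_of_value_eq_opt (hc : ∀ i, 0 < c i) (hp : ∀ i, 0 < p i)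
    {S : Finset (Fin n)} (hS : value c p S = opt c p) {i : Fin n} (hi : i ∈ S)
    (hpi : p i < 1 / 2) : (∑ k ∈ S, c k) / 2 < c i := by
  have hle : value c p (S.erase i) ≤ value c p S := hS ▸ value_le_opt c p _
  have hQ : 0 < ∏ k ∈ S.erase i, p k := prod_pos fun k _ => hp k
  have hC : 0 < ∑ k ∈ S, c k := sum_pos (fun k _ => hc k) ⟨i, hi⟩
  rw [value, value, ← mul_prod_erase S p hi, ← mul_assoc, mul_le_mul_iff_left₀ hQ] at hle
  have hsum := add_sum_erase S c hi
  nlinarith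

theorem eq_of_value_eq_opt (hc : ∀ i, 0 < c i) (hp : ∀ i, 0 < p i) {S : Finset (Fin n)}
    (hS : value c p S = opt c p) {i j : Fin n} (hi : i ∈ S) (hj : j ∈ S) (hpi : p i < 1 / 2)
    (hpj : p j < 1 / 2) : i = j := by
  by_contra hne
  have h1 := half_sum_lt_of_value_eq_opt hc hp hS hi hpi
  have h2 := half_sum_lt_of_value_eq_opt hc hp hS hj hpj
  have h3 : ∑ k ∈ ({i, j} : Finset (Fin n)), c k ≤ ∑ k ∈ S, c k :=
    sum_le_sum_of_subset_of_nonneg (by simp [insert_subset_iff, hi, hj]) fun k _ _ => (hc k).le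
  rw [sum_pair hne] at h3
  linarith

end Opt

/-! ## The scheme -/

section Scheme

variable {n : ℕ}

/-- The items of probability at least `1/2`, as listed by the algorithm. -/
noncomputable def bigItems (p : Fin n → ℝ) : List (Fin n) := (splitItems p).val.1

/-- The items of probability less than `1/2`, as listed by the algorithm. -/
noncomputable def smallItems (p : Fin n → ℝ) : List (Fin n) := (splitItems p).val.2

/-- The scaling factor of the algorithm. -/
noncomputable def scale (c p : Fin n → ℝ) (ε : ℝ) : ℝ := (scaleFactor c p ε (bigItems p)).val

/-- The scaled profits of the algorithm. -/
noncomputable def scaled (c p : Fin n → ℝ) (ε : ℝ) : Fin n → ℕ :=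
  (scaleProfits c (scale c p ε)).val

theorem mem_bigItems {p : Fin n → ℝ} {i : Fin n} : i ∈ bigItems p ↔ 1 / 2 ≤ p i := by
  simp [bigItems, splitItems_val]

theorem mem_smallItems {p : Fin n → ℝ} {i : Fin n} : i ∈ smallItems p ↔ p i < 1 / 2 := by
  simp [smallItems, splitItems_val]

theorem nodup_bigItems (p : Fin n → ℝ) : (bigItems p).Nodup := by
  simpa [bigItems, splitItems_val] using (List.nodup_finRange n).filter _

theorem nodup_smallItems (p : Fin n → ℝ) : (smallItems p).Nodup := by
  simpa [smallItems, splitItems_val] using (List.nodup_finRange n).filter _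

theorem length_bigItems_le (p : Fin n → ℝ) : (bigItems p).length ≤ n := by
  simpa using (nodup_bigItems p).length_le_card

theorem length_smallItems_le (p : Fin n → ℝ) : (smallItems p).length ≤ n := by
  simpa using (nodup_smallItems p).length_le_card

theorem approxScheme_of_bigItems_eq_nil {p : Fin n → ℝ} (h : bigItems p = []) (c : Fin n → ℝ)
    (ε : ℝ) : approxScheme c p ε = (do
      let _ ← splitItems p
      let z ← loop (smallItems p) 0 (trySingle c p)
      loop (bigItems p) z (trySingle c p)) := by
  have h' : (splitItems p).val = ([], smallItems p) := Prod.ext h rfl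
  simp only [approxScheme, bind, h', h]
  rfl

theorem approxScheme_of_bigItems_ne_nil {p : Fin n → ℝ} (h : bigItems p ≠ []) (c : Fin n → ℝ)
    (ε : ℝ) : approxScheme c p ε = (do
      let _ ← splitItems p
      let z ← loop (smallItems p) 0 (trySingle c p)
      let z ← loop (bigItems p) z (trySingle c p)
      let κ ← scaleFactor c p ε (bigItems p)
      let ch ← scaleProfits c κ
      let z ← loop (smallItems p) z fun j z => do
        let w ← readA ch j
        let q ← readA p j
        let v ← scaledDP ch p (bigItems p) w q
        let v ← mulR κ v
        maxR z v
      let v ← scaledDP ch p (bigItems p) 0 1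
      let v ← mulR κ v
      maxR z v) := by
  obtain ⟨i, l, hl⟩ := List.exists_cons_of_ne_nil h
  have h' : (splitItems p).val = (i :: l, smallItems p) := Prod.ext hl rfl
  simp only [approxScheme, bind, h', hl]

theorem approxScheme_val_le_iff (c p : Fin n → ℝ) (ε x : ℝ) :
    (approxScheme c p ε).val ≤ x ↔ 0 ≤ x ∧ (∀ j, c j * p j ≤ x) ∧ (bigItems p ≠ [] →
      (∀ j ∈ smallItems p, scale c p ε *
        (scaledDP (scaled c p ε) p (bigItems p) (scaled c p ε j) (p j)).val ≤ x) ∧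
      scale c p ε * (scaledDP (scaled c p ε) p (bigItems p) 0 1).val ≤ x) := by
  have hall : ∀ P : Fin n → Prop,
      ((∀ j ∈ smallItems p, P j) ∧ ∀ j ∈ bigItems p, P j) ↔ ∀ j, P j := fun P =>
    ⟨fun h j => (lt_or_ge (p j) (1 / 2)).elim (fun hj => h.1 j (mem_smallItems.2 hj))
      fun hj => h.2 j (mem_bigItems.2 hj), fun h => ⟨fun j _ => h j, fun j _ => h j⟩⟩
  rw [← hall]
  by_cases h : bigItems p = []
  · rw [approxScheme_of_bigItems_eq_nil h]
    simp only [bind_val]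
    rw [loop_max_le_iff _ _ _ _ _ (fun j z => trySingle_val c p j z),
      loop_max_le_iff _ _ _ _ _ (fun j z => trySingle_val c p j z)]
    simp [h]
  · rw [approxScheme_of_bigItems_ne_nil h]
    simp only [bind_val]
    rw [maxR, step_val, max_le_iff, loop_max_le_iff _ _ _ _ _ fun _ _ => rfl,
      loop_max_le_iff _ _ _ _ _ (fun j z => trySingle_val c p j z),
      loop_max_le_iff _ _ _ _ _ (fun j z => trySingle_val c p j z)]
    simp only [h, ne_eq, not_false_eq_true, true_imp_iff, and_assoc]
    rfl

/-- The runs for the small items and the dummy cost at most 27 + 27 units of n²(B + 1); all other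
work is at most 29n + 5, whence 88. -/
theorem approxScheme_steps_le (c p : Fin n → ℝ) (ε : ℝ) (hn : 1 ≤ n) (B : ℕ)
    (hB : bigItems p ≠ [] → ∑ i ∈ (bigItems p).toFinset, scaled c p ε i ≤ B) :
    (approxScheme c p ε).steps ≤ 88 * (n * (n * (B + 1))) := by
  have hb := length_bigItems_le p
  have hs := length_smallItems_le p
  have h1 := splitItems_steps_le p
  have h2 := loop_trySingle_steps_le c p (smallItems p) 0
  have h3 := loop_trySingle_steps_le c p (bigItems p) (loop (smallItems p) 0 (trySingle c p)).val
  have h4 : n ≤ n * (n * (B + 1)) :=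
    Nat.le_mul_of_pos_right _ (Nat.mul_pos (by omega) (by omega))
  by_cases h : bigItems p = []
  · rw [approxScheme_of_bigItems_eq_nil h]
    simp only [bind_steps]
    omega
  · have hdp : ∀ w q, (scaledDP (scaled c p ε) p (bigItems p) w q).steps ≤ 27 * (n * (B + 1)) := by
      intro w q
      refine (scaledDP_steps_le _ p hb hn w q).trans ?_
      rw [sumProfits_val _ (nodup_bigItems p)]
      have := hB h
      gcongr
    have h5 := scaleFactor_steps_le c p ε (bigItems p)
    have h6 := scaleProfits_steps_le c (scale c p ε)
    have h7 := fun z => loop_steps_le (smallItems p) z (fun j z => do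
        let w ← readA (scaled c p ε) j
        let q ← readA p j
        let v ← scaledDP (scaled c p ε) p (bigItems p) w q
        let v ← mulR (scale c p ε) v
        maxR z v) (27 * (n * (B + 1)) + 4) (by
      intro j z
      have := hdp (scaled c p ε j) (p j)
      simp only [bind_steps, readA, mulR, maxR, step_steps, step_val]
      omega)
    have h8 := hdp 0 1
    have h9 : (smallItems p).length * (27 * (n * (B + 1)) + 4 + 1) ≤
        27 * (n * (n * (B + 1))) + 5 * n := by
      refine (Nat.mul_le_mul_right _ hs).trans_eq ?_
      ring
    have h10 : n * (B + 1) ≤ n * (n * (B + 1)) := Nat.le_mul_of_pos_left _ hn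
    rw [approxScheme_of_bigItems_ne_nil h]
    simp only [bind_steps]
    have h11 := h7 (loop (bigItems p) (loop (smallItems p) 0 (trySingle c p)).val
      (trySingle c p)).val
    simp only [scaled, scale] at h5 h6 h11 h8
    simp only [mulR, maxR, step_steps] at h11 ⊢
    omega

end Scheme

/-! ## Analysis -/

section Analysis

variable {n : ℕ} {c p : Fin n → ℝ} {ε : ℝ}

/-- These are the only properties of the maximum in κ that matter: `m ≤ opt c p` controls the error,
and dominating the big items controls the table width. -/
theorem exists_scale_eq (hc : ∀ i, 0 < c i) (hp : ∀ i, 0 < p i) (h : bigItems p ≠ []) (ε : ℝ) :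
    ∃ m, scale c p ε = ε * m / n ∧ 0 < m ∧ m ≤ opt c p ∧ ∀ i ∈ bigItems p, c i * p i ≤ m := by
  have hle := (loop_max_le_iff (bigItems p) 0 _ _ _ (fun j z => trySingle_val c p j z)).1 le_rfl
  obtain ⟨i, hi⟩ := List.exists_mem_of_ne_nil _ h
  refine ⟨_, scaleFactor_val c p ε (bigItems p),
    (mul_pos (hc i) (hp i)).trans_le (hle.2 i hi), ?_, hle.2⟩
  rw [loop_max_le_iff _ _ _ _ _ fun j z => trySingle_val c p j z]
  have hval : ∀ j, c j * p j ≤ opt c p := fun j => value_singleton c p j ▸ value_le_opt c p {j}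
  exact ⟨(mul_pos (hc i) (hp i)).le.trans (hval i), fun j _ => hval j⟩

theorem scale_pos (hc : ∀ i, 0 < c i) (hp : ∀ i, 0 < p i) (h : bigItems p ≠ []) (hε : 0 < ε)
    (hn : 1 ≤ n) : 0 < scale c p ε := by
  obtain ⟨m, hm, hm0, -⟩ := exists_scale_eq hc hp h ε
  rw [hm]
  have : (0 : ℝ) < n := by exact_mod_cast hn
  positivity

theorem scale_mul_scaled_le (hc : ∀ i, 0 < c i) (hκ : 0 < scale c p ε) (i : Fin n) :
    scale c p ε * scaled c p ε i ≤ c i := by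
  rw [scaled, scaleProfits_val, mul_comm, ← le_div_iff₀ hκ]
  exact Nat.floor_le (div_pos (hc i) hκ).le

theorem le_scale_mul_scaled_add (hκ : 0 < scale c p ε) (i : Fin n) :
    c i ≤ scale c p ε * scaled c p ε i + scale c p ε := by
  rw [scaled, scaleProfits_val, ← mul_add_one, mul_comm, ← div_le_iff₀ hκ]
  exact (Nat.lt_floor_add_one _).le

theorem approxScheme_val_le_opt (hc : ∀ i, 0 < c i) (hp : ∀ i, 0 < p i) (hε : 0 < ε)
    (hn : 1 ≤ n) : (approxScheme c p ε).val ≤ opt c p := by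
  have h0 : 0 ≤ opt c p := by simpa [value] using value_le_opt c p ∅
  refine (approxScheme_val_le_iff c p ε _).2 ⟨h0, fun j => value_singleton c p j ▸
    value_le_opt c p {j}, fun h => ?_⟩
  have hκ := scale_pos hc hp h hε hn
  have key : ∀ S : Finset (Fin n),
      scale c p ε * ((∑ i ∈ S, scaled c p ε i : ℕ) : ℝ) * ∏ i ∈ S, p i ≤ opt c p := by
    intro S
    refine le_trans ?_ (value_le_opt c p S)
    refine mul_le_mul_of_nonneg_right ?_ (prod_nonneg fun i _ => (hp i).le)
    rw [Nat.cast_sum, mul_sum]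
    exact sum_le_sum fun i _ => scale_mul_scaled_le hc hκ i
  have hx : 0 ≤ opt c p / scale c p ε := div_nonneg h0 hκ.le
  constructor
  · intro j hj
    rw [mul_comm, ← le_div_iff₀ hκ]
    refine scaledDP_val_le (fun i => (hp i).le) (nodup_bigItems p) hx fun T hT => ?_
    -- The forced item is small and `T` consists of big items, so the candidate belongs to the
    -- genuine set `insert j T`.
    have hjT : j ∉ T := fun hjT =>
      (mem_smallItems.1 hj).not_ge (mem_bigItems.1 (List.mem_toFinset.1 (hT hjT)))
    have := key (insert j T)
    rw [sum_insert hjT, prod_insert hjT, add_comm] at this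
    rw [le_div_iff₀ hκ]
    linarith
  · rw [mul_comm, ← le_div_iff₀ hκ]
    refine scaledDP_val_le (fun i => (hp i).le) (nodup_bigItems p) hx fun T _ => ?_
    have := key T
    rw [le_div_iff₀ hκ, add_zero]
    linarith

theorem one_sub_mul_value_le (hp : ∀ i, 0 < p i ∧ p i < 1) (hε : 0 < ε) (hn : 1 ≤ n)
    (hc : ∀ i, 0 < c i) (h : bigItems p ≠ []) {S : Finset (Fin n)} (hS : value c p S = opt c p) :
    (1 - ε) * opt c p ≤
      scale c p ε * (((∑ i ∈ S, scaled c p ε i : ℕ) : ℝ) * ∏ i ∈ S, p i) := by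
  have hp0 := fun i => (hp i).1
  obtain ⟨m, hm, hm0, hmopt, -⟩ := exists_scale_eq hc hp0 h ε
  have hκ := scale_pos hc hp0 h hε hn
  have hn0 : (0 : ℝ) < n := by exact_mod_cast hn
  have hQ0 : 0 ≤ ∏ i ∈ S, p i := prod_nonneg fun i _ => (hp0 i).le
  have hQ1 : ∏ i ∈ S, p i ≤ 1 := prod_le_one (fun i _ => (hp0 i).le) fun i _ => (hp i).2.le
  have hsum : ∑ i ∈ S, c i ≤ scale c p ε * ((∑ i ∈ S, scaled c p ε i : ℕ) : ℝ) + ε * m := by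
    calc ∑ i ∈ S, c i ≤ ∑ i ∈ S, (scale c p ε * scaled c p ε i + scale c p ε) :=
          sum_le_sum fun i _ => le_scale_mul_scaled_add hκ i
      _ = scale c p ε * ((∑ i ∈ S, scaled c p ε i : ℕ) : ℝ) + S.card * scale c p ε := by
          rw [sum_add_distrib, sum_const, nsmul_eq_mul, Nat.cast_sum, mul_sum]
      _ ≤ _ := by
          have hcard : (S.card : ℝ) ≤ n := by exact_mod_cast card_finset_fin_le S
          have : (n : ℝ) * scale c p ε = ε * m := by rw [hm]; field_simp
          rw [← this]
          gcongr
  have hv := mul_le_mul_of_nonneg_right hsum hQ0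
  have h1 : ε * m * ∏ i ∈ S, p i ≤ ε * opt c p :=
    (mul_le_of_le_one_right (by positivity) hQ1).trans (by gcongr)
  have : opt c p = (∑ i ∈ S, c i) * ∏ i ∈ S, p i := hS.symm
  nlinarith

theorem one_sub_mul_opt_le_approxScheme_val (hc : ∀ i, 0 < c i) (hp : ∀ i, 0 < p i ∧ p i < 1)
    (hε : 0 < ε) (hn : 1 ≤ n) : (1 - ε) * opt c p ≤ (approxScheme c p ε).val := by
  have hp0 := fun i => (hp i).1
  obtain ⟨hz0, hz1, hz2⟩ := (approxScheme_val_le_iff c p ε _).1 le_rfl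
  obtain ⟨S, hS⟩ := exists_value_eq_opt c p
  have hopt : 0 ≤ opt c p := by simpa [value] using value_le_opt c p ∅
  -- If the optimum has a big item, a run of the dynamic program sees it; otherwise the single-item
  -- candidates already reach the optimum.
  by_cases hT : (S.filter fun i => 1 / 2 ≤ p i).Nonempty
  · have hbig : bigItems p ≠ [] := by
      obtain ⟨i, hi⟩ := hT
      exact List.ne_nil_of_mem (mem_bigItems.2 (mem_filter.1 hi).2)
    have hκ := scale_pos hc hp0 hbig hε hn
    obtain ⟨hsm, hdummy⟩ := hz2 hbig
    have hsub : (S.filter fun i => 1 / 2 ≤ p i) ⊆ (bigItems p).toFinset := fun i hi =>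
      List.mem_toFinset.2 (mem_bigItems.2 (mem_filter.1 hi).2)
    have hmain := one_sub_mul_value_le hp hε hn hc hbig hS
    by_cases hj : ∃ j ∈ S, p j < 1 / 2
    · obtain ⟨j, hjS, hj⟩ := hj
      have hST : insert j (S.filter fun i => 1 / 2 ≤ p i) = S := by
        ext i
        rw [mem_insert, mem_filter]
        constructor
        · rintro (rfl | hi)
          exacts [hjS, hi.1]
        · intro hi
          rcases lt_or_ge (p i) (1 / 2) with h | h
          · exact Or.inl (eq_of_value_eq_opt hc hp0 hS hi hjS h hj)
          · exact Or.inr ⟨hi, h⟩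
      have hjT : j ∉ S.filter fun i => 1 / 2 ≤ p i := fun h => hj.not_ge (mem_filter.1 h).2
      refine hmain.trans (le_trans ?_ (hsm j (mem_smallItems.2 hj)))
      refine mul_le_mul_of_nonneg_left (le_trans (le_of_eq ?_) (le_scaledDP_val
        (fun i => (hp0 i).le) (nodup_bigItems p) _ (hp0 j).le hsub hT)) hκ.le
      conv_lhs => rw [← hST, sum_insert hjT, prod_insert hjT]
      rw [add_comm]
      ring
    · have hST : (S.filter fun i => 1 / 2 ≤ p i) = S :=
        filter_true_of_mem fun i hi => le_of_not_gt fun h => hj ⟨i, hi, h⟩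
      rw [hST] at hT hsub
      refine hmain.trans (le_trans ?_ hdummy)
      refine mul_le_mul_of_nonneg_left (le_trans (le_of_eq ?_) (le_scaledDP_val
        (fun i => (hp0 i).le) (nodup_bigItems p) 0 zero_le_one hsub hT)) hκ.le
      rw [add_zero, mul_one]
  · have hsmall : ∀ i ∈ S, p i < 1 / 2 := fun i hi =>
      lt_of_not_ge fun h => hT ⟨i, mem_filter.2 ⟨hi, h⟩⟩
    have hle : opt c p ≤ (approxScheme c p ε).val := by
      rw [← hS]
      rcases S.eq_empty_or_nonempty with rfl | ⟨j, hj⟩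
      · simpa [value] using hz0
      · have : S = {j} := eq_singleton_iff_unique_mem.2 ⟨hj, fun i hi =>
          eq_of_value_eq_opt hc hp0 hS hi hj (hsmall i hi) (hsmall j hj)⟩
        rw [this, value_singleton]
        exact hz1 j
    nlinarith

theorem sum_scaled_le (hc : ∀ i, 0 < c i) (hp : ∀ i, 0 < p i) (hε : 0 < ε) (hn : 1 ≤ n)
    (h : bigItems p ≠ []) :
    ((∑ i ∈ (bigItems p).toFinset, scaled c p ε i : ℕ) : ℝ) ≤ 2 * (n : ℝ) ^ 2 / ε := by
  obtain ⟨m, hm, hm0, -, hmax⟩ := exists_scale_eq hc hp h ε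
  have hκ := scale_pos hc hp h hε hn
  have hn0 : (0 : ℝ) < n := by exact_mod_cast hn
  have hi : ∀ i ∈ (bigItems p).toFinset, (scaled c p ε i : ℝ) ≤ 2 * n / ε := by
    intro i hi
    have hi := List.mem_toFinset.1 hi
    have h1 := scale_mul_scaled_le (ε := ε) hc hκ i
    -- This is where the threshold 1/2 bounds the table: c_i ≤ 2 c_i p_i for big items.
    have h2 : c i ≤ 2 * m := by nlinarith [hmax i hi, mem_bigItems.1 hi, hc i]
    refine le_of_mul_le_mul_left (h1.trans (h2.trans_eq ?_)) hκ
    rw [hm]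
    field_simp
  rw [Nat.cast_sum]
  refine (sum_le_card_nsmul _ _ _ hi).trans ?_
  have hcard : ((bigItems p).toFinset.card : ℝ) ≤ n := by exact_mod_cast card_finset_fin_le _
  rw [nsmul_eq_mul, show 2 * (n : ℝ) ^ 2 / ε = n * (2 * n / ε) by ring]
  gcongr

theorem approxScheme_steps_le_div (hc : ∀ i, 0 < c i) (hp : ∀ i, 0 < p i) (hε : 0 < ε)
    (hε1 : ε ≤ 1) (hn : 1 ≤ n) :
    ((approxScheme c p ε).steps : ℝ) ≤ 264 * ((n : ℝ) ^ 4 / ε) := by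
  have hsteps := approxScheme_steps_le c p ε hn ⌊2 * (n : ℝ) ^ 2 / ε⌋₊
    fun h => Nat.le_floor (sum_scaled_le hc hp hε hn h)
  have hn1 : (1 : ℝ) ≤ n := by exact_mod_cast hn
  -- Here `ε ≤ 1` is needed: it absorbs the extra column into n²/ε, giving the factor 3 and 264 = 88
  -- · 3.
  have hone : 1 ≤ (n : ℝ) ^ 2 / ε := (one_le_div hε).2 (hε1.trans (one_le_pow₀ hn1))
  have hfl : (⌊2 * (n : ℝ) ^ 2 / ε⌋₊ : ℝ) ≤ 2 * (n : ℝ) ^ 2 / ε := Nat.floor_le (by positivity)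
  calc ((approxScheme c p ε).steps : ℝ)
      ≤ 88 * (n * (n * ((⌊2 * (n : ℝ) ^ 2 / ε⌋₊ : ℝ) + 1))) := by exact_mod_cast hsteps
    _ ≤ 88 * (n * (n * (3 * ((n : ℝ) ^ 2 / ε)))) := by
        have : (⌊2 * (n : ℝ) ^ 2 / ε⌋₊ : ℝ) + 1 ≤ 3 * ((n : ℝ) ^ 2 / ε) := by
          rw [mul_div_assoc] at hfl ⊢
          linarith
        gcongr
    _ = 264 * ((n : ℝ) ^ 4 / ε) := by ring

end Analysis

end AllOrNothing

theorem mainTheorem2 :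
    ∃ K : ℝ, ∀ (n : ℕ) (c p : Fin n → ℝ) (ε : ℝ), 1 ≤ n → (∀ i, 0 < c i) →
      (∀ i, 0 < p i ∧ p i < 1) → 0 < ε →
        (1 - ε) * AllOrNothing.opt c p ≤ (AllOrNothing.approxScheme c p ε).val ∧
        (AllOrNothing.approxScheme c p ε).val ≤ AllOrNothing.opt c p ∧
        (ε ≤ 1 → ((AllOrNothing.approxScheme c p ε).steps : ℝ) ≤ K * ((n : ℝ) ^ 4 / ε)) :=
  ⟨264, fun _ _ _ _ hn hc hp hε =>
    ⟨AllOrNothing.one_sub_mul_opt_le_approxScheme_val hc hp hε hn,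
      AllOrNothing.approxScheme_val_le_opt hc (fun i => (hp i).1) hε hn,
      fun hε1 => AllOrNothing.approxScheme_steps_le_div hc (fun i => (hp i).1) hε hε1 hn⟩⟩
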